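/- Let $\Phi$ be a crystallographic root system in a Euclidean space with positive roots $\Phi^+$, let $V$ be its span, let $N=\#\Phi^+$, and let $m\ge 1$ be an integer. The extended Shi arrangement $\mathsf{Shi}^{(m)}(\Phi)$ consists of the affine hyperplanes $\{x\in V:(\alpha,x)=k\}$ for $\alpha\in\Phi^+$ and integers $-m<k\le m$. A positive region is a connected component $R$ of the complement of the union of these hyperplanes in $V$ that lies in the fundamental chamber $\{x\in V:(\alpha,x)>0\text{ for all }\alpha\in\Phi^+\}$. Its coheight is $\operatorname{coh}(R)=mN-\operatorname{h}(R)$, where $\operatorname{h}(R)$ is the number of hyperplanes of $\mathsf{Shi}^{(m)}(\Phi)$ that separate $R$ from the fundamental region $\{x\in V:0<(\alpha,x)<1\text{ for all }\alpha\in\Phi^+\}$. Put $$\operatorname{Cat}^{(m)}(\Phi,q)=\sum_R q^{\operatorname{coh}(R)},$$ where $R$ ranges over all positive regions. For $n\ge 0$ let $A_{n-1}$ have positive roots $e_i-e_j$ $(1\le i<j\le n)$ and let $B_n$ have positive roots $e_i$ $(1\le i\le n)$ and $e_i\pm e_j$ $(1\le i<j\le n)$ in $\mathbb{R}^n$ (for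 $n=0$ there are no roots and $V=0$). An $m$-Catalan path is a partition $\lambda=(\lambda_1\ge\dots\ge\lambda_{n-1}\ge 0)$ that fits inside $((n-1)m,\dots,2m,m)$, that is, $\lambda_i\le (n-i)m$ for all $i$; its area is $\sum_{i=1}^{n-1}\big((n-i)m-\lambda_i\big)$, the number of boxes of $((n-1)m,\dots,2m,m)$ outside $\lambda$. The Carlitz $q$-Fuß–Catalan number is $\operatorname{Cat}_n^{(m)}(q)=\sum_\lambda q^{\operatorname{area}(\lambda)}$, summed over all $m$-Catalan paths. A type $B$ Catalan path of length $n$ is a lattice path of $2n$ unit steps, each north or east, that starts at $(0,0)$ and stays weakly above the diagonal $x=y$. Its area is the number of boxes in the region confined by the path, the diagonal $x=y$ and the anti-diagonal $x=2n-y$, not counting the halfboxes at the diagonal $x=y$ but counting the halfboxes at the anti-diagonal. Let $\operatorname{Cat}_{B_n}(q)=\sum_\lambda q^{\operatorname{area}(\lambda)}$, summed over all type $B$ Catalan paths $\lambda$ of length $n$. Theorem. For all integers $m\ge 1$ and $n\ge 0$, $$\operatorname{Cat}^{(m)}(A_{n-1},q)=\operatorname{Cat}_n^{(m)}(q)\qquad\text{and}\qquad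 \operatorname{Cat}^{(1)}(B_n,q)=\operatorname{Cat}_{B_n}(q).$$ -/

import Mathlib

open Polynomial

namespace Shi

noncomputable section

/-! ### The extended Shi arrangement and the coheight statistic

Throughout, `P` is the set of positive roots of a crystallographic root system in a Euclidean space
`E`; the arrangement lives in the subspace spanned by the roots. -/

section Arrangement

variable {E : Type*} [NormedAddCommGroup E] [InnerProductSpace ℝ E]

/-- The ambient space of the arrangement, i.e. the span of the roots. -/
abbrev ambient (P : Set E) : Submodule ℝ E := Submodule.span ℝ P

/-- The affine hyperplane `(α, x) = k`. -/
def hyperplane (P : Set E) (α : E) (k : ℤ) : Set (ambient P) :=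
  {x | inner ℝ α (x : E) = (k : ℝ)}

/-- The extended Shi arrangement: the hyperplanes `(α, x) = k` for `α` a positive root and
`-m < k ≤ m`. -/
def arrangement (P : Set E) (m : ℕ) : Set (Set (ambient P)) :=
  {H | ∃ α ∈ P, ∃ k : ℤ, -(m : ℤ) < k ∧ k ≤ m ∧ H = hyperplane P α k}

/-- The complement of the union of all hyperplanes of the arrangement. -/
def complement (P : Set E) (m : ℕ) : Set (ambient P) := (⋃₀ arrangement P m)ᶜ

/-- The fundamental chamber of the Coxeter arrangement. -/
def fundamentalChamber (P : Set E) : Set (ambient P) :=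
  {x | ∀ α ∈ P, 0 < inner ℝ α (x : E)}

/-- The regions of the arrangement: the connected components of its complement. -/
def regions (P : Set E) (m : ℕ) : Set (Set (ambient P)) :=
  {R | ∃ x ∈ complement P m, R = connectedComponentIn (complement P m) x}

/-- The positive regions: the regions that lie in the fundamental chamber. -/
def positiveRegions (P : Set E) (m : ℕ) : Set (Set (ambient P)) :=
  {R | R ∈ regions P m ∧ R ⊆ fundamentalChamber P}

/-- The fundamental region `0 < (α, x) < 1` for all positive roots `α`. -/
def fundamentalRegion (P : Set E) : Set (ambient P) :=
  {x | ∀ α ∈ P, 0 < inner ℝ α (x : E) ∧ inner ℝ α (x : E) < 1}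

/-- The hyperplane `(α, x) = k` separates `R` from `S`: they lie strictly on different sides. -/
def Separates (P : Set E) (α : E) (k : ℤ) (R S : Set (ambient P)) : Prop :=
  ((∀ x ∈ R, (k : ℝ) < inner ℝ α (x : E)) ∧ ∀ y ∈ S, inner ℝ α (y : E) < (k : ℝ)) ∨
  ((∀ x ∈ R, inner ℝ α (x : E) < (k : ℝ)) ∧ ∀ y ∈ S, (k : ℝ) < inner ℝ α (y : E))

/-- The hyperplanes of the arrangement that separate `R` from the fundamental region. -/
def separatingHyperplanes (P : Set E) (m : ℕ) (R : Set (ambient P)) : Set (Set (ambient P)) :=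
  {H | ∃ α ∈ P, ∃ k : ℤ, -(m : ℤ) < k ∧ k ≤ m ∧ H = hyperplane P α k ∧
    Separates P α k R (fundamentalRegion P)}

/-- The height of a region. -/
def height (P : Set E) (m : ℕ) (R : Set (ambient P)) : ℕ := (separatingHyperplanes P m R).ncard

/-- The coheight `m * N - height`, where `N` is the number of positive roots. The subtraction does
not truncate on positive regions when `P` is finite and the fundamental region is nonempty (as it is
for root systems), see `height_le`. -/
def coheight (P : Set E) (m : ℕ) (R : Set (ambient P)) : ℕ := m * P.ncard - height P m R

/-- The combinatorial `q`-Fuß-Catalan number: the coheight generating function over the positive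
regions (of which there are finitely many, see `finite_positiveRegions`). -/
def qFussCatalan (P : Set E) (m : ℕ) : ℕ[X] :=
  ∑ᶠ R ∈ positiveRegions P m, X ^ coheight P m R

theorem nonempty_of_mem_regions {P : Set E} {m : ℕ} {R : Set (ambient P)}
    (hR : R ∈ regions P m) : R.Nonempty := by
  obtain ⟨x, hx, rfl⟩ := hR
  exact ⟨x, mem_connectedComponentIn hx⟩

theorem height_le {P : Set E} (hP : P.Finite) (h0 : (fundamentalRegion P).Nonempty) {m : ℕ}
    {R : Set (ambient P)} (hR : R ∈ positiveRegions P m) : height P m R ≤ m * P.ncard := by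
  classical
  obtain ⟨x, hx⟩ := nonempty_of_mem_regions hR.1
  obtain ⟨y, hy⟩ := h0
  have hfin : (P ×ˢ (↑(Finset.Icc (1 : ℤ) m) : Set ℤ)).Finite := hP.prod (Finset.finite_toSet _)
  have hsub : separatingHyperplanes P m R ⊆
      (fun p : E × ℤ => hyperplane P p.1 p.2) '' (P ×ˢ (↑(Finset.Icc (1 : ℤ) m) : Set ℤ)) := by
    rintro H ⟨α, hα, k, -, hk2, rfl, hs⟩
    refine ⟨(α, k), ⟨hα, ?_⟩, rfl⟩
    have hx' := hR.2 hx α hα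
    have hy' := hy α hα
    have hk : (0 : ℝ) < (k : ℝ) := by
      rcases hs with hs | hs
      · linarith [hs.2 y hy]
      · linarith [hs.1 x hx]
    have hk' : 0 < k := by exact_mod_cast hk
    simp only [Finset.coe_Icc, Set.mem_Icc]
    exact ⟨hk', hk2⟩
  calc height P m R ≤ _ := Set.ncard_le_ncard hsub (hfin.image _)
    _ ≤ _ := Set.ncard_image_le hfin
    _ = m * P.ncard := by
      rw [Set.ncard_prod, Set.ncard_coe_finset]
      simp [mul_comm]

theorem finite_positiveRegions {P : Set E} (hP : P.Finite) (m : ℕ) :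
    (positiveRegions P m).Finite := by
  classical
  let K : Set ℤ := Set.Ioc (-(m : ℤ)) m
  let σ : ambient P → Set (E × ℤ) := fun x =>
    {p ∈ P ×ˢ K | (p.2 : ℝ) < inner ℝ p.1 (x : E)}
  have hfin : (P ×ˢ K).Finite := hP.prod (Set.finite_Ioc _ _)
  have hmem : ∀ x : ambient P, x ∈ complement P m ↔
      ∀ α ∈ P, ∀ k ∈ K, inner ℝ α (x : E) ≠ (k : ℝ) := by
    intro x
    constructor
    · intro hx α hα k hk h
      exact hx ⟨hyperplane P α k, ⟨α, hα, k, hk.1, hk.2, rfl⟩, h⟩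
    · rintro h ⟨H, ⟨α, hα, k, h1, h2, rfl⟩, hH⟩
      exact h α hα k ⟨h1, h2⟩ hH
  have key : ∀ x ∈ complement P m, ∀ y ∈ complement P m, σ x = σ y →
      connectedComponentIn (complement P m) x = connectedComponentIn (complement P m) y := by
    intro x hx y hy hσ
    have hseg : segment ℝ x y ⊆ complement P m := by
      rintro z ⟨a, b, ha, hb, hab, rfl⟩
      rw [hmem]
      intro α hα k hk
      have h1 := (hmem x).1 hx α hα k hk
      have h2 := (hmem y).1 hy α hα k hk
      have h3 : ((k : ℝ) < inner ℝ α (x : E)) ↔ ((k : ℝ) < inner ℝ α (y : E)) := by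
        have := Set.ext_iff.1 hσ (α, k)
        simpa [σ, hα, hk] using this
      have h4 : inner ℝ α ((a • x + b • y : ambient P) : E) =
          a * inner ℝ α (x : E) + b * inner ℝ α (y : E) := by
        simp [inner_add_right, inner_smul_right]
      rw [h4]
      obtain rfl : b = 1 - a := by linarith
      by_cases h : (k : ℝ) < inner ℝ α (x : E)
      · have h' := h3.1 h
        apply ne_of_gt
        rcases eq_or_lt_of_le ha with rfl | ha'
        · simpa using h'
        · nlinarith [mul_pos ha' (sub_pos.2 h), mul_nonneg hb (sub_pos.2 h').le]
      · have h' : inner ℝ α (y : E) < (k : ℝ) :=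
          lt_of_le_of_ne (not_lt.1 (fun q => h (h3.2 q))) h2
        have h'' : inner ℝ α (x : E) < (k : ℝ) := lt_of_le_of_ne (not_lt.1 h) h1
        apply ne_of_lt
        rcases eq_or_lt_of_le ha with rfl | ha'
        · simpa using h'
        · nlinarith [mul_pos ha' (sub_pos.2 h''), mul_nonneg hb (sub_pos.2 h').le]
    exact connectedComponentIn_eq
      ((convex_segment x y).isPreconnected.subset_connectedComponentIn
        (left_mem_segment ℝ x y) hseg (right_mem_segment ℝ x y))
  have hfinσ : (σ '' complement P m).Finite :=
    hfin.finite_subsets.subset (by rintro _ ⟨x, -, rfl⟩; exact fun p hp => hp.1)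
  have hreg : (regions P m).Finite := by
    have : ∀ s ∈ σ '' complement P m, ∃ x ∈ complement P m, σ x = s := fun s hs => hs
    choose! f hf hfs using this
    refine (hfinσ.image fun s => connectedComponentIn (complement P m) (f s)).subset ?_
    rintro R ⟨x, hx, rfl⟩
    have hs : σ x ∈ σ '' complement P m := ⟨x, hx, rfl⟩
    exact ⟨σ x, hs, key _ (hf _ hs) _ hx (hfs _ hs)⟩
  exact hreg.subset fun R hR => hR.1

end Arrangement

/-! ### The root systems of types `A` and `B` -/

/-- The positive roots `eᵢ - eⱼ`, `i < j`, of type `A_{n-1}`. -/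
def positiveRootsA (n : ℕ) : Set (EuclideanSpace ℝ (Fin n)) :=
  {v | ∃ i j : Fin n, i < j ∧ v = EuclideanSpace.single i 1 - EuclideanSpace.single j 1}

/-- The positive roots `eᵢ` and `eᵢ ± eⱼ`, `i < j`, of type `B_n`. -/
def positiveRootsB (n : ℕ) : Set (EuclideanSpace ℝ (Fin n)) :=
  {v | (∃ i : Fin n, v = EuclideanSpace.single i 1) ∨
    (∃ i j : Fin n, i < j ∧ v = EuclideanSpace.single i 1 - EuclideanSpace.single j 1) ∨
    (∃ i j : Fin n, i < j ∧ v = EuclideanSpace.single i 1 + EuclideanSpace.single j 1)}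

end

/-! ### Catalan paths of type `A` -/

/-- The `m`-Catalan paths: the partitions `l 0 ≥ l 1 ≥ ⋯ ≥ l (n - 1)` that fit inside the partition
`((n - 1) m, …, 2 m, m, 0)`. The last part, which is forced to be `0`, is kept for convenience. -/
def catalanPathsA (n m : ℕ) : Finset (Fin n → ℕ) :=
  {l ∈ Fintype.piFinset fun i : Fin n => Finset.range (m * (n - 1 - i) + 1) |
    ∀ i j : Fin n, i ≤ j → l j ≤ l i}

/-- The area of an `m`-Catalan path: the number of boxes of the partition
`((n - 1) m, …, 2 m, m)` that are not boxes of the given partition. -/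
def areaA {n : ℕ} (m : ℕ) (l : Fin n → ℕ) : ℕ := ∑ i : Fin n, (m * (n - 1 - i) - l i)

/-- The Carlitz `q`-Fuß-Catalan number. -/
noncomputable def carlitzFussCatalan (n m : ℕ) : ℕ[X] :=
  ∑ l ∈ catalanPathsA n m, X ^ areaA m l

/-! ### Catalan paths of type `B` -/

/-- The number of north steps (`true`) among the first `t` steps, i.e. the `y`-coordinate after
`t` steps. -/
def north {N : ℕ} (w : Fin N → Bool) (t : ℕ) : ℕ :=
  (Finset.univ.filter fun s : Fin N => (s : ℕ) < t ∧ w s = true).card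

/-- The number of east steps (`false`) among the first `t` steps, i.e. the `x`-coordinate after
`t` steps. -/
def east {N : ℕ} (w : Fin N → Bool) (t : ℕ) : ℕ :=
  (Finset.univ.filter fun s : Fin N => (s : ℕ) < t ∧ w s = false).card

/-- The type `B` Catalan paths of length `n`: lattice paths with `2 n` north or east steps that
start at the origin and stay weakly above the diagonal `x = y`. -/
def catalanPathsB (n : ℕ) : Finset (Fin (2 * n) → Bool) :=
  Finset.univ.filter fun w : Fin (2 * n) → Bool =>
    ∀ t : Fin (2 * n + 1), east w t ≤ north w t

/-- The area of a type `B` Catalan path. The box `[a, a + 1] × [b, b + 1]` lies strictly above the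
diagonal `x = y` (it is not a halfbox on it) iff `a < b`; it is a box or a halfbox below the
anti-diagonal `x = 2 n - y` iff `a + b < 2 n`; and it is below and to the right of the path iff the
path has a north step from height `b` to height `b + 1` at an `x`-coordinate that is at most `a`. -/
def areaB {n : ℕ} (w : Fin (2 * n) → Bool) : ℕ :=
  (((Finset.range (2 * n)) ×ˢ (Finset.range (2 * n))).filter fun p : ℕ × ℕ =>
    p.1 < p.2 ∧ p.1 + p.2 < 2 * n ∧
      ∃ s : Fin (2 * n), w s = true ∧ north w s = p.2 ∧ east w s ≤ p.1).card

/-- The area generating function of the type `B` Catalan paths of length `n`. -/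
noncomputable def catalanB (n : ℕ) : ℕ[X] := ∑ w ∈ catalanPathsB n, X ^ areaB w

end Shi

/-! A positive region is convex and is cut out by the answers to the questions `k < (α, x)` for
positive roots `α` and `1 ≤ k ≤ m`. Each answer "yes" is a hyperplane separating it from the
fundamental region, so the coheight counts the answers "no". Both identities thus reduce, through
`qFussCatalan_eq_sum`, to encoding the realizable answers by combinatorial objects whose weight is
the number of "no"s.

Type A. Let `l i` be the number of pairs `(j, k)` with `j > i` and `x j + k < x i`. Since `x`
decreases, so does `l`, and the area of `l` is the coheight. The row of `i` is an initial segment of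
the numbers `x j + k`, whose order is decided by the rows of larger index; hence the sizes of the
rows determine the rows (`lt_sub_iff_of_card_rowA_eq`). Conversely, choosing `x i` downward in `i`,
just above `l i` of these numbers, realizes every path (`exists_card_rowA_eq`).

Type B, `m = 1`. Listing `e₀, …, eₙ₋₁, 0, -eₙ₋₁, …, -e₀` as `ε₀, …, ε₂ₙ`, the positive roots are the
differences `εₐ - ε_b` over the boxes `a < b`, `a + b < 2 n`. The roots with value below `1` form an
ideal of boxes; every ideal occurs (`exists_antisymmExtend_sub_lt_one_iff`). The same ideals are the
sets of boxes confined by the type `B` paths, since a path goes north exactly on the diagonal and at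
the corners of its confined boxes (`north_step_iff`). -/

namespace Shi

/-! ### Positive regions as sign vectors -/

section PositiveRegions

variable {E : Type*} [NormedAddCommGroup E] [InnerProductSpace ℝ E]

/-- The points of the fundamental chamber that lie on no hyperplane `(α, v) = k`, `1 ≤ k ≤ m`. -/
def positivePoints (P : Set E) (m : ℕ) : Set E :=
  {v | ∀ α ∈ P, 0 < inner ℝ α v ∧ ∀ k ∈ Finset.Icc 1 m, inner ℝ α v ≠ (k : ℝ)}

theorem mem_complement {P : Set E} {m : ℕ} {x : ambient P} :
    x ∈ complement P m ↔
      ∀ α ∈ P, ∀ k : ℤ, -(m : ℤ) < k → k ≤ m → inner ℝ α (x : E) ≠ (k : ℝ) := by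
  constructor
  · intro hx α hα k h1 h2 h
    exact hx ⟨hyperplane P α k, ⟨α, hα, k, h1, h2, rfl⟩, h⟩
  · rintro h ⟨H, ⟨α, hα, k, h1, h2, rfl⟩, hH⟩
    exact h α hα k h1 h2 hH

theorem coe_mem_positivePoints {P : Set E} {m : ℕ} {x : ambient P} :
    (x : E) ∈ positivePoints P m ↔ x ∈ complement P m ∧ x ∈ fundamentalChamber P := by
  rw [mem_complement]
  constructor
  · intro h
    refine ⟨fun α hα k _ hk hx => ?_, fun α hα => (h α hα).1⟩
    have hpos : (0 : ℝ) < k := hx ▸ (h α hα).1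
    have hpos' : 0 < k := by exact_mod_cast hpos
    lift k to ℕ using hpos'.le
    exact (h α hα).2 k (by simp only [Finset.mem_Icc]; omega) (by simpa using hx)
  · rintro ⟨h1, h2⟩ α hα
    refine ⟨h2 α hα, fun k hk hx => ?_⟩
    rw [Finset.mem_Icc] at hk
    exact h1 α hα k (by omega) (by omega) (by simpa using hx)

/-- Intermediate values: the image of a component under `(α, ·)` is an interval that avoids `k`. -/
theorem lt_inner_of_mem_connectedComponentIn {P : Set E} {m : ℕ} {x y : ambient P}
    (hy : y ∈ connectedComponentIn (complement P m) x) {α : E} (hα : α ∈ P) {k : ℤ}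
    (hk : -(m : ℤ) < k) (hkm : k ≤ m) (h : (k : ℝ) < inner ℝ α (x : E)) :
    (k : ℝ) < inner ℝ α (y : E) := by
  have hx : x ∈ complement P m := by
    by_contra hx
    simp [connectedComponentIn_eq_empty hx] at hy
  have hc : Continuous fun z : ambient P => inner ℝ α (z : E) := by fun_prop
  by_contra hlt
  have hconn := (isPreconnected_connectedComponentIn (F := complement P m) (x := x)).image _
    hc.continuousOn
  obtain ⟨z, hz, hzk⟩ := hconn.ordConnected.out (Set.mem_image_of_mem _ hy)
    (Set.mem_image_of_mem _ (mem_connectedComponentIn hx)) ⟨not_lt.1 hlt, h.le⟩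
  exact mem_complement.1 (connectedComponentIn_subset _ _ hz) α hα k hk hkm hzk

/-- For `m ≥ 1` the walls `(α, x) = 0` belong to the arrangement, so a component cannot cross them.
-/
theorem connectedComponentIn_subset_fundamentalChamber {P : Set E} {m : ℕ} (hm : 1 ≤ m)
    {x : ambient P} (hx : x ∈ fundamentalChamber P) :
    connectedComponentIn (complement P m) x ⊆ fundamentalChamber P := by
  intro y hy α hα
  simpa using lt_inner_of_mem_connectedComponentIn hy hα (k := 0) (by omega) (by omega)
    (by simpa using hx α hα)

/-- Both sides of a hyperplane are convex, so points with equal answers are joined by a segment in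
the complement. Levels `k ≤ 0` need no test, as all roots are positive on the segment. -/
theorem connectedComponentIn_eq_iff {P : Set E} {m : ℕ} {x y : ambient P}
    (hx : (x : E) ∈ positivePoints P m) (hy : (y : E) ∈ positivePoints P m) :
    connectedComponentIn (complement P m) x = connectedComponentIn (complement P m) y ↔
      ∀ α ∈ P, ∀ k ∈ Finset.Icc 1 m,
        ((k : ℝ) < inner ℝ α (x : E) ↔ (k : ℝ) < inner ℝ α (y : E)) := by
  have hxc := (coe_mem_positivePoints.1 hx).1
  have hyc := (coe_mem_positivePoints.1 hy).1
  constructor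
  · intro h α hα k hk
    rw [Finset.mem_Icc] at hk
    have h1 : y ∈ connectedComponentIn (complement P m) x := h ▸ mem_connectedComponentIn hyc
    have h2 : x ∈ connectedComponentIn (complement P m) y := h ▸ mem_connectedComponentIn hxc
    exact ⟨fun h' => by
        simpa using lt_inner_of_mem_connectedComponentIn h1 hα (k := k) (by omega) (by omega)
          (by simpa using h'),
      fun h' => by
        simpa using lt_inner_of_mem_connectedComponentIn h2 hα (k := k) (by omega) (by omega)
          (by simpa using h')⟩
  · intro h
    have hseg : segment ℝ x y ⊆ complement P m := by
      rintro z ⟨a, b, ha, hb, hab, rfl⟩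
      refine (coe_mem_positivePoints.1 fun α hα => ?_).1
      have hlin : inner ℝ α ((a • x + b • y : ambient P) : E) =
          a • inner ℝ α (x : E) + b • inner ℝ α (y : E) := by
        simp [inner_add_right, inner_smul_right]
      rw [hlin]
      refine ⟨convex_Ioi (0 : ℝ) (hx α hα).1 (hy α hα).1 ha hb hab, fun k hk => ?_⟩
      by_cases hlt : (k : ℝ) < inner ℝ α (x : E)
      · exact (convex_Ioi (k : ℝ) hlt ((h α hα k hk).1 hlt) ha hb hab).ne'
      · have hlt' := mt (h α hα k hk).2 hlt
        exact (convex_Iio (k : ℝ) (lt_of_le_of_ne (not_lt.1 hlt) ((hx α hα).2 k hk))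
          (lt_of_le_of_ne (not_lt.1 hlt') ((hy α hα).2 k hk)) ha hb hab).ne
    exact connectedComponentIn_eq
      ((convex_segment x y).isPreconnected.subset_connectedComponentIn
        (left_mem_segment ℝ x y) hseg (right_mem_segment ℝ x y))

/-- The height counts hyperplanes as sets, so distinct pairs `(α, k)` must give distinct sets. Take
`p` on the hyperplane of `α` and let `v` be the part of `β` orthogonal to `α`. Both `p` and `p + v`
lie on the common hyperplane, so `v` is orthogonal to `β` as well, hence to itself; thus `β` is a
multiple of `α`. -/
theorem hyperplane_injective {P : Set E} (h0 : (0 : E) ∉ P)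
    (hred : ∀ α ∈ P, ∀ β ∈ P, ∀ c : ℝ, β = c • α → β = α) {α β : E} (hα : α ∈ P) (hβ : β ∈ P)
    {k l : ℤ} (h : hyperplane P α k = hyperplane P β l) : α = β ∧ k = l := by
  have hα0 : α ≠ 0 := fun h => h0 (h ▸ hα)
  have hn : ‖α‖ ^ 2 ≠ 0 := pow_ne_zero 2 (norm_ne_zero_iff.2 hα0)
  set p : ambient P := (k / inner ℝ α α : ℝ) • ⟨α, Submodule.subset_span hα⟩ with hp
  set v : ambient P := ⟨β, Submodule.subset_span hβ⟩ -
    (inner ℝ α β / inner ℝ α α : ℝ) • ⟨α, Submodule.subset_span hα⟩ with hv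
  have hpα : inner ℝ α (p : E) = (k : ℝ) := by
    simp [hp, inner_smul_right, hn]
  have hvα : inner ℝ α (v : E) = (0 : ℝ) := by
    simp [hv, inner_sub_right, inner_smul_right, hn]
  have hpβ : p ∈ hyperplane P β l := h ▸ hpα
  have hpvβ : p + v ∈ hyperplane P β l := by
    rw [← h]
    change inner ℝ α ((p + v : ambient P) : E) = (k : ℝ)
    simp only [Submodule.coe_add, inner_add_right, hpα, hvα, add_zero]
  have hvβ : inner ℝ β (v : E) = (0 : ℝ) := by
    have h1 : inner ℝ β (p : E) = (l : ℝ) := hpβ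
    have h2 : inner ℝ β ((p + v : ambient P) : E) = (l : ℝ) := hpvβ
    rw [Submodule.coe_add, inner_add_right] at h2
    linarith
  have hvv : inner ℝ (v : E) (v : E) = (0 : ℝ) := by
    have : (v : E) = β - (inner ℝ α β / inner ℝ α α : ℝ) • α := rfl
    conv_lhs => arg 2; rw [this]
    rw [inner_sub_left, inner_smul_left, hvα, hvβ]
    simp
  have hβα : β = α := by
    refine hred α hα β hβ (inner ℝ α β / inner ℝ α α : ℝ) ?_
    have : (v : E) = β - (inner ℝ α β / inner ℝ α α : ℝ) • α := rfl
    rw [inner_self_eq_zero, this, sub_eq_zero] at hvv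
    exact hvv
  subst hβα
  have : (k : ℝ) = l := hpα.symm.trans hpβ
  exact ⟨rfl, by exact_mod_cast this⟩

/-- Roots are positive on both regions, so levels `k ≤ 0` separate nothing; and the fundamental
region lies below every level `k ≥ 1`. -/
theorem separates_fundamentalRegion_iff {P : Set E} (h0 : (fundamentalRegion P).Nonempty) {m : ℕ}
    {x : ambient P} (hx : (x : E) ∈ positivePoints P m) {α : E} (hα : α ∈ P) {k : ℤ}
    (hk : -(m : ℤ) < k) (hkm : k ≤ m) :
    Separates P α k (connectedComponentIn (complement P m) x) (fundamentalRegion P) ↔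
      1 ≤ k ∧ (k : ℝ) < inner ℝ α (x : E) := by
  obtain ⟨z, hz⟩ := h0
  have hxR := mem_connectedComponentIn (coe_mem_positivePoints.1 hx).1
  constructor
  · rintro (⟨h1, h2⟩ | ⟨h1, h2⟩)
    · have : (0 : ℝ) < k := (hz α hα).1.trans (h2 z hz)
      exact ⟨by exact_mod_cast this, h1 x hxR⟩
    · have h3 : (0 : ℝ) < k := (hx α hα).1.trans (h1 x hxR)
      have h4 : (k : ℝ) < 1 := (h2 z hz).trans (hz α hα).2
      norm_cast at h3 h4
      omega
  · rintro ⟨h1, h2⟩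
    refine Or.inl ⟨fun y hy => lt_inner_of_mem_connectedComponentIn hy hα hk hkm h2,
      fun y hy => (hy α hα).2.trans_le (by exact_mod_cast h1)⟩

theorem height_connectedComponentIn {κ : Type*} {r : κ → E} {I : Finset κ}
    (hr : Set.InjOn r I) (h0 : (fundamentalRegion (r '' I)).Nonempty)
    (hred : ∀ α ∈ r '' I, ∀ β ∈ r '' I, ∀ c : ℝ, β = c • α → β = α) {m : ℕ}
    {x : ambient (r '' I)} (hx : (x : E) ∈ positivePoints (r '' I) m) :
    height (r '' I) m (connectedComponentIn (complement (r '' I) m) x) =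
      ((I ×ˢ Finset.Icc 1 m).filter fun p => (p.2 : ℝ) < inner ℝ (r p.1) (x : E)).card := by
  have h0P : (0 : E) ∉ r '' I := by
    intro h
    obtain ⟨z, hz⟩ := h0
    simpa using (hz 0 h).1
  rw [height, ← Set.ncard_coe_finset]
  have himg : separatingHyperplanes (r '' I) m (connectedComponentIn (complement (r '' I) m) x) =
      (fun p : κ × ℕ => hyperplane (r '' I) (r p.1) p.2) ''
        ↑((I ×ˢ Finset.Icc 1 m).filter fun p => (p.2 : ℝ) < inner ℝ (r p.1) (x : E)) := by
    ext H
    constructor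
    · rintro ⟨α, hα, k, hk, hkm, rfl, hs⟩
      rw [separates_fundamentalRegion_iff h0 hx hα hk hkm] at hs
      obtain ⟨i, hi, rfl⟩ := hα
      obtain ⟨hk1, hs⟩ := hs
      lift k to ℕ using by omega
      refine ⟨(i, k), ?_, rfl⟩
      simp only [Finset.coe_filter, Finset.mem_product, Finset.mem_Icc, Set.mem_ofPred_eq]
      exact ⟨⟨hi, by omega⟩, by simpa using hs⟩
    · rintro ⟨⟨i, k⟩, hp, rfl⟩
      simp only [Finset.coe_filter, Finset.mem_product, Finset.mem_Icc, Set.mem_ofPred_eq] at hp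
      refine ⟨r i, ⟨i, hp.1.1, rfl⟩, k, by omega, by omega, rfl, ?_⟩
      rw [separates_fundamentalRegion_iff h0 hx ⟨i, hp.1.1, rfl⟩ (by omega) (by omega)]
      exact ⟨by omega, by simpa using hp.2⟩
  rw [himg, Set.InjOn.ncard_image]
  rintro ⟨i, k⟩ hp ⟨j, l⟩ hq h
  simp only [Finset.coe_filter, Finset.mem_product, Finset.mem_Icc, Set.mem_ofPred_eq] at hp hq
  obtain ⟨h1, h2⟩ := hyperplane_injective h0P hred (Set.mem_image_of_mem r hp.1.1)
    (Set.mem_image_of_mem r hq.1.1) h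
  rw [hr hp.1.1 hq.1.1 h1]
  simpa using h2

/-- The coheight generating function, computed by means of a statistic `Ψ` on the points of the
space that is a complete invariant of the positive regions. -/
theorem qFussCatalan_eq_sum [FiniteDimensional ℝ E] {κ ι : Type*} {r : κ → E} {I : Finset κ}
    (hr : Set.InjOn r I) {m : ℕ} (hm : 1 ≤ m)
    (h0 : ∃ v : E, ∀ i ∈ I, 0 < inner ℝ (r i) v ∧ inner ℝ (r i) v < (1 : ℝ))
    (hred : ∀ α ∈ r '' I, ∀ β ∈ r '' I, ∀ c : ℝ, β = c • α → β = α)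
    (T : Finset ι) (Ψ : E → ι) (w : ι → ℕ)
    (hmaps : ∀ v ∈ positivePoints (r '' I) m, Ψ v ∈ T)
    (hsurj : ∀ t ∈ T, ∃ v ∈ positivePoints (r '' I) m, Ψ v = t)
    (hΨ : ∀ u ∈ positivePoints (r '' I) m, ∀ v ∈ positivePoints (r '' I) m,
      (Ψ u = Ψ v ↔ ∀ i ∈ I, ∀ k ∈ Finset.Icc 1 m,
        ((k : ℝ) < inner ℝ (r i) u ↔ (k : ℝ) < inner ℝ (r i) v)))
    (hw : ∀ v ∈ positivePoints (r '' I) m, w (Ψ v) =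
      ((I ×ˢ Finset.Icc 1 m).filter fun p => ¬ (p.2 : ℝ) < inner ℝ (r p.1) v).card) :
    qFussCatalan (r '' I) m = ∑ t ∈ T, X ^ w t := by
  -- The roots see only the orthogonal projection to their span, so witnesses may be sought in all
  -- of `E`.
  have hproj : ∀ v : E, ∃ x : ambient (r '' I), ∀ i ∈ I, inner ℝ (r i) (x : E) = inner ℝ (r i) v :=
    fun v => ⟨(ambient (r '' I)).orthogonalProjectionOnto v, fun i hi =>
      Submodule.inner_orthogonalProjectionOnto_eq_of_mem_left
        (⟨r i, Submodule.subset_span ⟨i, hi, rfl⟩⟩ : ambient (r '' I)) v⟩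
  have h0' : (fundamentalRegion (r '' I)).Nonempty := by
    obtain ⟨v, hv⟩ := h0
    obtain ⟨x, hx⟩ := hproj v
    refine ⟨x, ?_⟩
    rintro _ ⟨i, hi, rfl⟩
    rw [hx i hi]
    exact hv i hi
  have hpick : ∀ t ∈ T, ∃ x : ambient (r '' I), (x : E) ∈ positivePoints (r '' I) m ∧
      Ψ (x : E) = t := by
    intro t ht
    obtain ⟨v, hv, rfl⟩ := hsurj t ht
    obtain ⟨x, hx⟩ := hproj v
    have hxp : (x : E) ∈ positivePoints (r '' I) m := by
      rintro _ ⟨i, hi, rfl⟩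
      rw [hx i hi]
      exact hv _ ⟨i, hi, rfl⟩
    exact ⟨x, hxp, (hΨ _ hxp v hv).2 fun i hi k _ => by rw [hx i hi]⟩
  choose! f hf hfΨ using hpick
  have hiff : ∀ x y : ambient (r '' I), (x : E) ∈ positivePoints (r '' I) m →
      (y : E) ∈ positivePoints (r '' I) m →
      (connectedComponentIn (complement (r '' I) m) x =
        connectedComponentIn (complement (r '' I) m) y ↔ Ψ (x : E) = Ψ (y : E)) := by
    intro x y hx hy
    rw [connectedComponentIn_eq_iff hx hy, hΨ _ hx _ hy, Set.forall_mem_image]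
    rfl
  have hbij : Set.BijOn (fun t => connectedComponentIn (complement (r '' I) m) (f t)) ↑T
      (positiveRegions (r '' I) m) := by
    refine ⟨fun t ht => ?_, fun s hs t ht h => ?_, ?_⟩
    · have := coe_mem_positivePoints.1 (hf t ht)
      exact ⟨⟨f t, this.1, rfl⟩, connectedComponentIn_subset_fundamentalChamber hm this.2⟩
    · have := (hiff _ _ (hf s hs) (hf t ht)).1 h
      rwa [hfΨ s hs, hfΨ t ht] at this
    · rintro R ⟨⟨x, hx, rfl⟩, hR⟩
      have hxp : (x : E) ∈ positivePoints (r '' I) m :=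
        coe_mem_positivePoints.2 ⟨hx, hR (mem_connectedComponentIn hx)⟩
      have ht := hmaps _ hxp
      exact ⟨Ψ x, ht, (hiff _ _ (hf _ ht) hxp).2 (hfΨ _ ht)⟩
  rw [qFussCatalan, ← finsum_mem_coe_finset]
  symm
  refine finsum_mem_eq_of_bijOn _ hbij fun t ht => ?_
  have hcard := Finset.card_filter_add_card_filter_not (s := I ×ˢ Finset.Icc 1 m)
    (fun p => (p.2 : ℝ) < inner ℝ (r p.1) (f t : E))
  rw [← hw _ (hf t ht), hfΨ t ht, ← height_connectedComponentIn hr h0' hred (hf t ht),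
    Finset.card_product, Nat.card_Icc] at hcard
  have hP : (r '' I).ncard = I.card := by
    rw [hr.ncard_image, Set.ncard_coe_finset]
  congr 1
  rw [coheight, hP]
  rw [mul_comm I.card] at hcard
  simp only [Nat.add_sub_cancel] at hcard
  omega

/-- A set of vectors with coordinates `0` and `±1` that lies in an open half-space contains no two
proportional vectors. -/
theorem eq_of_eq_smul_of_coord {n : ℕ} {P : Set (EuclideanSpace ℝ (Fin n))}
    (hP : ∀ α ∈ P, ∀ i, α i = 0 ∨ α i = 1 ∨ α i = -1) {v : EuclideanSpace ℝ (Fin n)}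
    (hv : ∀ α ∈ P, (0 : ℝ) < inner ℝ α v) :
    ∀ α ∈ P, ∀ β ∈ P, ∀ c : ℝ, β = c • α → β = α := by
  rintro α hα β hβ c rfl
  have hc : 0 < c := by
    have h1 := hv _ hβ
    rw [inner_smul_left] at h1
    exact (pos_iff_pos_of_mul_pos h1).2 (hv α hα)
  ext i
  have h1 := hP _ hβ i
  have h2 := hP α hα i
  simp only [PiLp.smul_apply, smul_eq_mul] at h1 ⊢
  rcases h2 with h | h | h <;> rw [h] at h1 ⊢ <;> rcases h1 with h1 | h1 | h1 <;> linarith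

end PositiveRegions


/-! ### Type A: regions and `m`-Catalan paths -/

section TypeA

/-- Finitely many values leave a gap just above `L`, and the complement of a countable set is dense
in it. -/
theorem exists_gt_notMem_forall_le_iff_lt {κ : Type*} (S : Finset κ) (g : κ → ℝ) {Z : Set ℝ}
    (hZ : Z.Countable) (L : ℝ) : ∃ t, L < t ∧ t ∉ Z ∧ ∀ p ∈ S, (g p < t ↔ g p ≤ L) := by
  classical
  obtain ⟨b, hLb, hb⟩ := Order.exists_between_finsets {L} ((S.image g).filter (L < ·))
    (by simp)
  obtain ⟨t, htZ, hLt, htb⟩ := (hZ.dense_compl ℝ).exists_between (hLb L (by simp))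
  refine ⟨t, hLt, htZ, fun p hp => ⟨fun h => ?_, fun h => h.trans_lt hLt⟩⟩
  by_contra hlt
  have := hb (g p) (by simpa using ⟨⟨p, hp, rfl⟩, not_le.1 hlt⟩)
  linarith

/-- A real number outside a countable set can be placed above `L` and exactly `c` of the distinct
values `g p`. -/
theorem exists_gt_notMem_card_filter_lt {κ : Type*} {S : Finset κ} {g : κ → ℝ}
    (hg : Set.InjOn g S) {Z : Set ℝ} (hZ : Z.Countable) {L : ℝ} {c : ℕ}
    (hLc : (S.filter fun p => g p ≤ L).card ≤ c) (hc : c ≤ S.card) :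
    ∃ t, L < t ∧ t ∉ Z ∧ (S.filter fun p => g p < t).card = c := by
  classical
  induction c, hLc using Nat.le_induction with
  | base =>
    obtain ⟨t, h1, h2, h3⟩ := exists_gt_notMem_forall_le_iff_lt S g hZ L
    exact ⟨t, h1, h2, by rw [Finset.filter_congr h3]⟩
  | succ c _ ih =>
    obtain ⟨t, hLt, htZ, htc⟩ := ih (by omega)
    have hne : (S.filter fun p => ¬ g p < t).Nonempty := by
      rw [← Finset.card_pos]
      have := Finset.card_filter_add_card_filter_not (s := S) (fun p => g p < t)
      omega
    -- Passing just beyond the smallest value not yet below `t` raises the count by exactly one,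
    -- because the values are distinct.
    obtain ⟨q, hq, hmin⟩ := Finset.exists_min_image _ g hne
    rw [Finset.mem_filter, not_lt] at hq
    obtain ⟨u, h1, h2, h3⟩ := exists_gt_notMem_forall_le_iff_lt S g hZ (g q)
    refine ⟨u, by linarith, h2, ?_⟩
    have : (S.filter fun p => g p < u) = insert q (S.filter fun p => g p < t) := by
      ext p
      rw [Finset.mem_insert, Finset.mem_filter, Finset.mem_filter]
      constructor
      · rintro ⟨hp, hpu⟩
        by_cases hpt : g p < t
        · exact Or.inr ⟨hp, hpt⟩
        · exact Or.inl (hg hp hq.1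
            (le_antisymm ((h3 p hp).1 hpu) (hmin p (Finset.mem_filter.2 ⟨hp, hpt⟩))))
      · rintro (rfl | ⟨hp, hpt⟩)
        · exact ⟨hq.1, h1⟩
        · exact ⟨hp, by linarith⟩
    rw [this, Finset.card_insert_of_notMem, htc]
    rw [Finset.mem_filter]
    exact fun h => h.2.not_ge hq.2

/-- The pairs `(j, k)` with `i < j` and `1 ≤ k ≤ m` such that `x` lies beyond the hyperplane
`x i - x j = k`. -/
noncomputable def rowA {n : ℕ} (m : ℕ) (x : Fin n → ℝ) (i : Fin n) : Finset (Fin n × ℕ) :=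
  (Finset.Ioi i ×ˢ Finset.Icc 1 m).filter fun p => (p.2 : ℝ) < x i - x p.1

theorem mem_rowA {n m : ℕ} {x : Fin n → ℝ} {i : Fin n} {p : Fin n × ℕ} :
    p ∈ rowA m x i ↔ (i < p.1 ∧ 1 ≤ p.2 ∧ p.2 ≤ m) ∧ (p.2 : ℝ) < x i - x p.1 := by
  simp [rowA]

theorem card_rowA_le {n m : ℕ} (x : Fin n → ℝ) (i : Fin n) :
    (rowA m x i).card ≤ m * (n - 1 - i) := by
  refine (Finset.card_filter_le _ _).trans ?_
  rw [Finset.card_product, Fin.card_Ioi, Nat.card_Icc, mul_comm, Nat.add_sub_cancel]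

theorem card_rowA_anti {n m : ℕ} {x : Fin n → ℝ} (hx : StrictAnti x) {i j : Fin n} (hij : i ≤ j) :
    (rowA m x j).card ≤ (rowA m x i).card := by
  refine Finset.card_le_card fun p hp => ?_
  rw [mem_rowA] at hp ⊢
  have := hx.antitone hij
  exact ⟨⟨hij.trans_lt hp.1.1, hp.1.2⟩, by linarith⟩

/-- Downward induction on `i`. If neither row contained the other, a pair `(a, k)` only in the row
of `x` and a pair `(b, l)` only in that of `y` would give `x a - x b < l - k < y a - y b`. Since `|l
- k| < m`, this contradicts the induction hypothesis for `a` and `b`, or is absurd when `a = b`. So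
the rows are nested, and equal cardinality makes them equal. -/
theorem lt_sub_iff_of_card_rowA_eq {n m : ℕ} {x y : Fin n → ℝ} (hx : StrictAnti x)
    (hy : StrictAnti y) (h : ∀ i, (rowA m x i).card = (rowA m y i).card) (i j : Fin n)
    (hij : i < j) (k : ℕ) (hk : 1 ≤ k) (hkm : k ≤ m) :
    (k : ℝ) < x i - x j ↔ (k : ℝ) < y i - y j := by
  induction i using WellFoundedGT.induction generalizing j k with
  | ind i ih =>
    suffices hrow : rowA m x i = rowA m y i by
      have := Finset.ext_iff.1 hrow (j, k)
      simpa [mem_rowA, hij, hk, hkm] using this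
    by_cases hsub : rowA m x i ⊆ rowA m y i
    · exact Finset.eq_of_subset_of_card_le hsub (h i).ge
    by_cases hsub' : rowA m y i ⊆ rowA m x i
    · exact (Finset.eq_of_subset_of_card_le hsub' (h i).le).symm
    exfalso
    obtain ⟨⟨a, k⟩, hax, hay⟩ := Finset.not_subset.1 hsub
    obtain ⟨⟨b, l⟩, hby, hbx⟩ := Finset.not_subset.1 hsub'
    rw [mem_rowA] at hax hay hby hbx
    have hay' := not_lt.1 fun h => hay ⟨hax.1, h⟩
    have hbx' := not_lt.1 fun h => hbx ⟨hby.1, h⟩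
    obtain ⟨⟨hia, hk1, hkm⟩, hax⟩ := hax
    obtain ⟨⟨hib, hl1, hlm⟩, hby⟩ := hby
    dsimp only at *
    have h1 : x a - x b < (l : ℝ) - k := by linarith
    have h2 : (l : ℝ) - k < y a - y b := by linarith
    rcases lt_trichotomy a b with hab | rfl | hab
    · have hlk : (k : ℝ) < l := by linarith [hx hab]
      have hlk' : k < l := by exact_mod_cast hlk
      have := ih a hia b hab (l - k) (by omega) (by omega)
      rw [Nat.cast_sub hlk'.le] at this
      linarith [this.2 h2]
    · linarith
    · have hlk : (l : ℝ) < k := by linarith [hy hab]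
      have hlk' : l < k := by exact_mod_cast hlk
      have := ih b hib a hab (k - l) (by omega) (by omega)
      rw [Nat.cast_sub hlk'.le] at this
      linarith [this.1 (by linarith)]

theorem mem_catalanPathsA {n m : ℕ} {l : Fin n → ℕ} :
    l ∈ catalanPathsA n m ↔
      (∀ i, l i ≤ m * (n - 1 - i)) ∧ ∀ i j : Fin n, i ≤ j → l j ≤ l i := by
  simp [catalanPathsA]

/-- The coordinates are chosen from the last to the first. Nonintegral differences are carried
along: they keep the values `x j + k` distinct, so that any count can be hit, and keep the point off
the hyperplanes. -/
theorem exists_card_rowA_eq {n m : ℕ} {l : Fin n → ℕ} (hl : l ∈ catalanPathsA n m) (s : ℕ)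
    (hs : s ≤ n) : ∃ x : Fin n → ℝ, ∀ i : Fin n, s ≤ i →
      (∀ j, i < j → 0 < x i - x j ∧ ∀ z : ℤ, x i - x j ≠ z) ∧ (rowA m x i).card = l i := by
  rw [mem_catalanPathsA] at hl
  obtain ⟨hl1, hl2⟩ := hl
  induction hs using Nat.decreasingInduction with
  | self => exact ⟨0, fun i hi => absurd i.2 (by omega)⟩
  | of_succ s hs ih =>
    obtain ⟨x, hx⟩ := ih
    set i₀ : Fin n := ⟨s, hs⟩ with hi₀
    have hgt : ∀ i : Fin n, i₀ < i → s + 1 ≤ i := fun i hi => hi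
    have hinj : Set.InjOn (fun p : Fin n × ℕ => x p.1 + p.2)
        ↑(Finset.Ioi i₀ ×ˢ Finset.Icc 1 m) := by
      rintro ⟨a, k⟩ ha ⟨b, l⟩ hb hab
      simp only [Finset.coe_product, Finset.coe_Ioi, Set.mem_prod, Set.mem_Ioi] at ha hb hab
      rcases lt_trichotomy a b with h | rfl | h
      · exact absurd (by push_cast; linarith) (((hx a (hgt a ha.1)).1 b h).2 (l - k))
      · simpa using hab
      · exact absurd (by push_cast; linarith) (((hx b (hgt b hb.1)).1 a h).2 (k - l))
    have hL : ∃ L : ℝ, (∀ j, i₀ < j → x j ≤ L) ∧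
        ((Finset.Ioi i₀ ×ˢ Finset.Icc 1 m).filter
          fun p : Fin n × ℕ => x p.1 + p.2 ≤ L).card ≤ l i₀ := by
      by_cases hsn : s + 1 < n
      · set i₁ : Fin n := ⟨s + 1, hsn⟩ with hi₁
        have hle : ∀ j, i₀ < j → j = i₁ ∨ i₁ < j := fun j hj =>
          (eq_or_lt_of_le (show i₁ ≤ j from hgt j hj)).imp_left Eq.symm
        -- The new coordinate must exceed `x i₁`, the largest so far. The values at most `x i₁` all
        -- lie in the row of `i₁`, so there are at most `l i₁ ≤ l i₀` of them: here the monotonicity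
        -- of `l` is used.
        refine ⟨x i₁, fun j hj => ?_, ?_⟩
        · rcases hle j hj with rfl | h
          · exact le_rfl
          · linarith [((hx i₁ le_rfl).1 j h).1]
        · refine le_trans ?_ (hl2 i₀ i₁ (Nat.le_succ s))
          rw [← (hx i₁ le_rfl).2]
          refine Finset.card_le_card ?_
          rintro ⟨j, k⟩ hp
          simp only [Finset.mem_filter, Finset.mem_product, Finset.mem_Ioi, Finset.mem_Icc] at hp
          obtain ⟨⟨hj, hk1, hkm⟩, hle'⟩ := hp
          have hk1' : (1 : ℝ) ≤ k := by exact_mod_cast hk1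
          rcases hle j hj with rfl | h
          · linarith
          · have := ((hx i₁ le_rfl).1 j h).2 k
            rw [Int.cast_natCast] at this
            exact mem_rowA.2 ⟨⟨h, hk1, hkm⟩, lt_of_le_of_ne (by linarith) this.symm⟩
      · have hemp : Finset.Ioi i₀ = ∅ :=
          Finset.eq_empty_of_forall_notMem fun j hj => by
            have := hgt j (Finset.mem_Ioi.1 hj)
            omega
        exact ⟨0, fun j hj => by have := hgt j hj; omega, by simp [hemp]⟩
    obtain ⟨L, hLx, hLc⟩ := hL
    have hZ : (Set.range fun p : Fin n × ℤ => x p.1 + p.2).Countable := Set.countable_range _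
    obtain ⟨t, hLt, htZ, htc⟩ := exists_gt_notMem_card_filter_lt hinj hZ hLc (by
      rw [Finset.card_product, Fin.card_Ioi, Nat.card_Icc, mul_comm, Nat.add_sub_cancel]
      exact hl1 i₀)
    have hne : ∀ j, i₀ < j → Function.update x i₀ t j = x j := fun j hj =>
      Function.update_of_ne hj.ne' _ _
    refine ⟨Function.update x i₀ t, fun i hi => ?_⟩
    rcases eq_or_lt_of_le (show i₀ ≤ i from hi) with rfl | hi
    · refine ⟨fun j hj => ?_, ?_⟩
      · rw [hne j hj, Function.update_self]
        exact ⟨by linarith [hLx j hj], fun z hz => htZ ⟨(j, z), by simp only; linarith⟩⟩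
      · rw [← htc, rowA]
        refine congrArg _ (Finset.filter_congr fun p hp => ?_)
        simp only [Finset.mem_product, Finset.mem_Ioi] at hp
        rw [hne _ hp.1, Function.update_self, lt_sub_iff_add_lt']
    · refine ⟨fun j hj => ?_, ?_⟩
      · rw [hne i hi, hne j (hi.trans hj)]
        exact (hx i (hgt i hi)).1 j hj
      · rw [← (hx i (hgt i hi)).2, rowA, rowA]
        refine congrArg _ (Finset.filter_congr fun p hp => ?_)
        simp only [Finset.mem_product, Finset.mem_Ioi] at hp
        rw [hne i hi, hne _ (hi.trans hp.1)]

/-- The index set of the positive roots of type `A`. -/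
abbrev pairsA (n : ℕ) : Finset (Fin n × Fin n) :=
  Finset.univ.filter fun p => p.1 < p.2

theorem areaA_card_rowA {n m : ℕ} (x : Fin n → ℝ) :
    areaA m (fun i => (rowA m x i).card) =
      ((pairsA n ×ˢ Finset.Icc 1 m).filter
        fun p => ¬ (p.2 : ℝ) < x p.1.1 - x p.1.2).card := by
  rw [areaA, Finset.card_eq_sum_card_fiberwise (f := fun p => p.1.1) (t := Finset.univ)
    (by simp)]
  refine Finset.sum_congr rfl fun i _ => ?_
  have h1 := Finset.card_filter_add_card_filter_not (s := Finset.Ioi i ×ˢ Finset.Icc 1 m)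
    (fun p => (p.2 : ℝ) < x i - x p.1)
  rw [Finset.card_product, Fin.card_Ioi, Nat.card_Icc, Nat.add_sub_cancel, mul_comm] at h1
  rw [← h1, rowA, Nat.add_sub_cancel_left]
  refine Finset.card_nbij' (fun p => ((i, p.1), p.2)) (fun p => (p.1.2, p.2)) ?_ ?_ ?_ ?_
  · rintro ⟨j, k⟩ h
    simpa using h
  · rintro ⟨⟨i', j⟩, k⟩ h
    simp only [Finset.coe_filter, Finset.mem_filter, Finset.mem_product, Finset.mem_univ,
      true_and, Set.mem_ofPred_eq] at h
    obtain ⟨h, rfl⟩ := h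
    simpa using h
  · rintro ⟨j, k⟩ _
    rfl
  · rintro ⟨⟨i', j⟩, k⟩ h
    simp only [Finset.coe_filter, Set.mem_ofPred_eq] at h
    simp [h.2]

/-- The root `eᵢ - eⱼ` of the pair `(i, j)`. -/
noncomputable def rootA {n : ℕ} (p : Fin n × Fin n) : EuclideanSpace ℝ (Fin n) :=
  EuclideanSpace.single p.1 1 - EuclideanSpace.single p.2 1

theorem inner_rootA {n : ℕ} (p : Fin n × Fin n) (v : EuclideanSpace ℝ (Fin n)) :
    inner ℝ (rootA p) v = v p.1 - v p.2 := by
  simp [rootA, inner_sub_left, EuclideanSpace.inner_single_left]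

theorem rootA_apply {n : ℕ} (p : Fin n × Fin n) (i : Fin n) :
    rootA p i = (if i = p.1 then 1 else 0) - if i = p.2 then 1 else 0 := by
  simp [rootA, PiLp.single_apply]

theorem positiveRootsA_eq_image (n : ℕ) :
    positiveRootsA n = rootA '' (pairsA n : Set (Fin n × Fin n)) := by
  ext v
  constructor
  · rintro ⟨i, j, hij, rfl⟩
    exact ⟨(i, j), by simpa using hij, rfl⟩
  · rintro ⟨⟨i, j⟩, hij, rfl⟩
    exact ⟨i, j, by simpa using hij, rfl⟩

theorem injOn_rootA (n : ℕ) :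
    Set.InjOn rootA (pairsA n : Set (Fin n × Fin n)) := by
  rintro ⟨i, j⟩ hij ⟨i', j'⟩ hij' h
  simp only [Finset.coe_filter, Finset.mem_univ, true_and, Set.mem_ofPred_eq] at hij hij'
  have h1 := congrArg (fun v : EuclideanSpace ℝ (Fin n) => v i) h
  have h2 := congrArg (fun v : EuclideanSpace ℝ (Fin n) => v j) h
  simp only [rootA_apply, hij.ne, hij.ne', if_true, if_false] at h1 h2
  split_ifs at h1 h2 <;> first | (exfalso; linarith) | simp_all

theorem qFussCatalan_positiveRootsA {m : ℕ} (hm : 1 ≤ m) (n : ℕ) :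
    qFussCatalan (positiveRootsA n) m = carlitzFussCatalan n m := by
  have h0 : ∃ v : EuclideanSpace ℝ (Fin n),
      ∀ p ∈ pairsA n,
        0 < inner ℝ (rootA p) v ∧ inner ℝ (rootA p) v < (1 : ℝ) := by
    -- The differences are `(j - i) / n`, strictly between `0` and `1`.
    refine ⟨WithLp.toLp 2 fun i => -(i : ℝ) / n, ?_⟩
    rintro ⟨i, j⟩ hij
    have hij' : (i : ℕ) < j := by simpa using hij
    have hn : (0 : ℝ) < n := by exact_mod_cast (by omega : 0 < n)
    have h1 : (i : ℝ) < j := by exact_mod_cast hij'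
    have h2 : (j : ℝ) < n := by exact_mod_cast j.2
    have h3 : (0 : ℝ) ≤ i := by positivity
    rw [inner_rootA, ← sub_div]
    exact ⟨div_pos (by linarith) hn, by rw [div_lt_one hn]; linarith⟩
  have hpos : ∀ v ∈ positivePoints
      (rootA '' (pairsA n : Set (Fin n × Fin n))) m,
      StrictAnti fun i => v i := by
    intro v hv i j hij
    have := (hv _ ⟨(i, j), by simpa using hij, rfl⟩).1
    rw [inner_rootA] at this
    exact sub_pos.1 this
  rw [positiveRootsA_eq_image, carlitzFussCatalan]
  refine qFussCatalan_eq_sum (injOn_rootA n) hm h0 ?_ (catalanPathsA n m)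
    (fun v i => (rowA m (fun j => v j) i).card) (areaA m) ?_ ?_ ?_ ?_
  · obtain ⟨v, hv⟩ := h0
    refine eq_of_eq_smul_of_coord (v := v) ?_ ?_
    · rintro _ ⟨p, -, rfl⟩ i
      rw [rootA_apply]
      split_ifs <;> norm_num
    · rintro _ ⟨p, hp, rfl⟩
      exact (hv p hp).1
  · exact fun v hv => mem_catalanPathsA.2
      ⟨fun i => card_rowA_le _ i, fun i j hij => card_rowA_anti (hpos v hv) hij⟩
  · intro l hl
    obtain ⟨x, hx⟩ := exists_card_rowA_eq hl 0 n.zero_le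
    refine ⟨WithLp.toLp 2 x, ?_, funext fun i => (hx i (Nat.zero_le _)).2⟩
    rintro _ ⟨⟨i, j⟩, hij, rfl⟩
    rw [inner_rootA]
    have := (hx i (Nat.zero_le _)).1 j (by simpa using hij)
    exact ⟨this.1, fun k _ => by simpa using this.2 k⟩
  · intro u hu v hv
    constructor
    · rintro h ⟨i, j⟩ hij k hk
      rw [Finset.mem_Icc] at hk
      rw [inner_rootA, inner_rootA]
      exact lt_sub_iff_of_card_rowA_eq (hpos u hu) (hpos v hv) (congrFun h) i j
        (by simpa using hij) k hk.1 hk.2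
    · intro h
      funext i
      refine congrArg _ (Finset.filter_congr fun p hp => ?_)
      rw [Finset.mem_product, Finset.mem_Ioi] at hp
      have := h (i, p.1) (by simpa using hp.1) p.2 hp.2
      rwa [inner_rootA, inner_rootA] at this
  · intro v _
    rw [areaA_card_rowA]
    simp only [inner_rootA]

end TypeA


/-! ### Type B: regions and ideals of boxes -/

section TypeB

/-- The boxes `(a, b)` that lie strictly above the diagonal and not beyond the anti-diagonal. They
index the positive roots of type `B`. -/
def boxesB (n : ℕ) : Finset (ℕ × ℕ) :=
  ((Finset.range (2 * n)) ×ˢ (Finset.range (2 * n))).filter fun p =>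
    p.1 < p.2 ∧ p.1 + p.2 < 2 * n

theorem mem_boxesB {n : ℕ} {p : ℕ × ℕ} : p ∈ boxesB n ↔ p.1 < p.2 ∧ p.1 + p.2 < 2 * n := by
  simp only [boxesB, Finset.mem_filter, Finset.mem_product, Finset.mem_range]
  omega

/-- The sets of boxes that contain with a box every box below and to the right of it. -/
def idealsB (n : ℕ) : Finset (Finset (ℕ × ℕ)) :=
  (boxesB n).powerset.filter fun I =>
    ∀ p ∈ I, ∀ q ∈ boxesB n, p.1 ≤ q.1 → q.2 ≤ p.2 → q ∈ I

theorem mem_idealsB {n : ℕ} {I : Finset (ℕ × ℕ)} : I ∈ idealsB n ↔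
    I ⊆ boxesB n ∧ ∀ p ∈ I, ∀ q ∈ boxesB n, p.1 ≤ q.1 → q.2 ≤ p.2 → q ∈ I := by
  simp [idealsB]

/-- The antisymmetric extension of `x 0, …, x (n - 1), x n = 0` to the indices up to `2 n`. -/
def antisymmExtend (n : ℕ) (x : ℕ → ℝ) (b : ℕ) : ℝ := if b ≤ n then x b else -x (2 * n - b)

/-- The window from `s` to `2 n - s` involves only `x s, …, x n`, the coordinates already chosen in
the downward recursion that follows. -/
theorem antisymmExtend_lt {n s : ℕ} {x : ℕ → ℝ} (hn : x n = 0)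
    (hx : ∀ a, s ≤ a → a < n → x (a + 1) < x a) {a b : ℕ} (hsa : s ≤ a) (hab : a < b)
    (hb : b + s ≤ 2 * n) : antisymmExtend n x b < antisymmExtend n x a := by
  have key : ∀ a b, s ≤ a → a + 1 ≤ b → b ≤ n → x b < x a := by
    intro a b hsa hab
    induction b, hab using Nat.le_induction with
    | base => exact fun h => hx a hsa h
    | succ b hab ih => exact fun h => (hx b (by omega) h).trans (ih (by omega))
  unfold antisymmExtend
  split_ifs with hbn han han
  · exact key a b hsa hab hbn
  · omega
  · have h1 := key (2 * n - b) n (by omega) (by omega) le_rfl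
    rcases eq_or_lt_of_le han with rfl | han
    · linarith
    · have h2 := key a n hsa han le_rfl
      linarith
  · have := key (2 * n - b) (2 * n - a) (by omega) (by omega) (by omega)
    linarith

/-- Every ideal of boxes is the set of positive roots with value less than `1` at some point of the
fundamental chamber of type `B`. -/
theorem exists_antisymmExtend_sub_lt_one_iff {n : ℕ} {I : Finset (ℕ × ℕ)} (hI : I ∈ idealsB n)
    (s : ℕ) (hs : s ≤ n) : ∃ x : ℕ → ℝ, x n = 0 ∧ ∀ a, s ≤ a → a < n → x (a + 1) < x a ∧
      (∀ b, a < b → a + b < 2 * n → antisymmExtend n x a - antisymmExtend n x b ≠ 1 ∧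
        (antisymmExtend n x a - antisymmExtend n x b < 1 ↔ (a, b) ∈ I)) ∧
      ((a, 2 * n - 1 - a) ∈ I → x a < 1 / 2) := by
  classical
  rw [mem_idealsB] at hI
  obtain ⟨hIB, hI⟩ := hI
  induction hs using Nat.decreasingInduction with
  | self => exact ⟨0, rfl, fun a h1 h2 => by omega⟩
  | of_succ s hs ih =>
    obtain ⟨x, hxn, hx⟩ := ih
    set y := antisymmExtend n x with hy
    have hymono : ∀ {a b}, s + 1 ≤ a → a < b → b + (s + 1) ≤ 2 * n → y b < y a :=
      fun h1 h2 h3 => antisymmExtend_lt hxn (fun a ha han => (hx a ha han).1) h1 h2 h3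
    have hys : y (s + 1) = x (s + 1) := if_pos hs
    -- The bound `1 / 2` strengthens the induction. If `(s, 2 n - 1 - s)` is in `I`, then `x s + x
    -- (s + 1) < 1` and `x (s + 1) < x s` force `2 * x (s + 1) < 1`, which no root condition on the
    -- later coordinates provides.
    have hhalf : (s, 2 * n - 1 - s) ∈ I → x (s + 1) < 1 / 2 := by
      intro h
      rcases eq_or_lt_of_le (Nat.succ_le_of_lt hs) with h' | h'
      · rw [← Nat.succ_eq_add_one, h', hxn]
        norm_num
      · refine (hx (s + 1) le_rfl h').2.2 (hI _ h _ (mem_boxesB.2 ?_) ?_ ?_) <;>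
          dsimp only <;> omega
    set row := Finset.Ioo s (2 * n - s) with hrow
    -- The new coordinate must lie above all of `lo` and below all of `hi`; `hlohi` shows that the
    -- ideal property makes these demands compatible.
    set lo : Finset ℝ := insert (x (s + 1))
      ((row.filter fun b => (s, b) ∉ I).image fun b => y b + 1) with hlo
    set hi : Finset ℝ := ((row.filter fun b => (s, b) ∈ I).image fun b => y b + 1) ∪
      if (s, 2 * n - 1 - s) ∈ I then {1 / 2} else ∅ with hhi
    have hlohi : ∀ l ∈ lo, ∀ h ∈ hi, l < h := by
      intro l hl h hh
      simp only [hlo, Finset.mem_insert, Finset.mem_image, Finset.mem_filter, hrow,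
        Finset.mem_Ioo] at hl
      simp only [hhi, Finset.mem_union, Finset.mem_image, Finset.mem_filter, hrow,
        Finset.mem_Ioo] at hh
      rcases hh with ⟨b, ⟨⟨hsb, hb⟩, hbI⟩, rfl⟩ | hh
      · rcases hl with rfl | ⟨c, ⟨⟨hsc, hc⟩, hcI⟩, rfl⟩
        · rcases eq_or_lt_of_le (Nat.succ_le_of_lt hsb) with rfl | hsb'
          · rw [← hys]
            linarith
          · by_cases hb' : s + 1 + b < 2 * n
            · have := ((hx (s + 1) le_rfl (by omega)).2.1 b hsb' hb').2.2
                (hI _ hbI _ (mem_boxesB.2 ⟨hsb', hb'⟩) (Nat.le_succ s) le_rfl)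
              rw [← hys]
              linarith
            · obtain rfl : b = 2 * n - 1 - s := by omega
              have h1 := hhalf hbI
              have h2 : y (2 * n - 1 - s) = -x (s + 1) := by
                rw [hy, antisymmExtend, if_neg (by omega)]
                congr 2
                omega
              rw [h2]
              linarith
        · have hbc : b < c := by
            by_contra hcb
            exact hcI (hI _ hbI _ (mem_boxesB.2 ⟨hsc, by dsimp only; omega⟩) le_rfl
              (not_lt.1 hcb))
          linarith [hymono (by omega) hbc (by omega)]
      · split_ifs at hh with hmem
        · rw [Finset.mem_singleton] at hh
          subst hh
          rcases hl with rfl | ⟨c, ⟨⟨hsc, hc⟩, hcI⟩, rfl⟩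
          · exact hhalf hmem
          · exact absurd (hI _ hmem (s, c) (mem_boxesB.2 ⟨hsc, by dsimp only; omega⟩) le_rfl
              (by dsimp only; omega)) hcI
        · simp at hh
    obtain ⟨t, htlo, hthi⟩ := Order.exists_between_finsets lo hi hlohi
    have hne : ∀ b, s < b → s + b < 2 * n →
        antisymmExtend n (Function.update x s t) b = y b := by
      intro b h1 h2
      rw [hy, antisymmExtend, antisymmExtend, Function.update_of_ne (by omega),
        Function.update_of_ne (by omega)]
    have hns : antisymmExtend n (Function.update x s t) s = t := by
      rw [antisymmExtend, if_pos hs.le, Function.update_self]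
    refine ⟨Function.update x s t, by rw [Function.update_of_ne hs.ne', hxn], fun a ha han => ?_⟩
    rcases eq_or_lt_of_le ha with rfl | ha
    · refine ⟨?_, fun b h1 h2 => ?_, fun h => ?_⟩
      · rw [Function.update_self, Function.update_of_ne (by omega)]
        exact htlo _ (Finset.mem_insert_self _ _)
      · rw [hns, hne b h1 h2]
        have hb : b ∈ row := Finset.mem_Ioo.2 ⟨h1, by omega⟩
        by_cases hbI : (s, b) ∈ I
        · have := hthi (y b + 1) (Finset.mem_union_left _
            (Finset.mem_image_of_mem _ (Finset.mem_filter.2 ⟨hb, hbI⟩)))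
          exact ⟨by linarith, iff_of_true (by linarith) hbI⟩
        · have := htlo (y b + 1) (Finset.mem_insert_of_mem
            (Finset.mem_image_of_mem _ (Finset.mem_filter.2 ⟨hb, hbI⟩)))
          exact ⟨by linarith, iff_of_false (by linarith) hbI⟩
      · rw [Function.update_self]
        exact hthi _ (Finset.mem_union_right _ (by rw [if_pos h]; simp))
    · have := hx a ha han
      refine ⟨?_, fun b h1 h2 => ?_, fun h => ?_⟩
      · rw [Function.update_of_ne (by omega), Function.update_of_ne (by omega)]
        exact this.1
      · rw [hne b (by omega) (by omega), hne a ha (by omega)]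
        exact this.2.1 b h1 h2
      · rw [Function.update_of_ne (by omega)]
        exact this.2.2 h

/-- The vectors `e₀, …, eₙ₋₁, 0, -eₙ₋₁, …, -e₀`. -/
noncomputable def signedBasis (n a : ℕ) : EuclideanSpace ℝ (Fin n) :=
  WithLp.toLp 2 fun i => if (i : ℕ) = a then 1 else if i + a = 2 * n then -1 else 0

/-- The positive root of type `B` that belongs to a box. -/
noncomputable def rootB (n : ℕ) (p : ℕ × ℕ) : EuclideanSpace ℝ (Fin n) :=
  signedBasis n p.1 - signedBasis n p.2

theorem signedBasis_of_lt {n a : ℕ} (h : a < n) :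
    signedBasis n a = EuclideanSpace.single ⟨a, h⟩ 1 := by
  ext i
  simp only [signedBasis, PiLp.single_apply, Fin.ext_iff]
  split_ifs <;> first | rfl | omega

theorem signedBasis_self (n : ℕ) : signedBasis n n = 0 := by
  ext i
  simp only [signedBasis, PiLp.zero_apply]
  split_ifs <;> first | rfl | omega

theorem signedBasis_two_mul_sub {n a : ℕ} (h : a ≤ 2 * n) :
    signedBasis n (2 * n - a) = -signedBasis n a := by
  ext i
  simp only [signedBasis, PiLp.neg_apply]
  split_ifs <;> first | omega | simp

theorem rootB_apply {n : ℕ} {p : ℕ × ℕ} (hp : p ∈ boxesB n) (i : Fin n) :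
    rootB n p i = (if (i : ℕ) = p.1 then 1 else 0) - (if (i : ℕ) = p.2 then 1 else 0) +
      if i + p.2 = 2 * n then 1 else 0 := by
  rw [mem_boxesB] at hp
  simp only [rootB, signedBasis, PiLp.sub_apply]
  split_ifs <;> first | omega | norm_num

/-- The box `(a, b)` gives `eₐ - e_b`, `eₐ` or `eₐ + e_(2n-b)` according as `b < n`, `b = n` or `b >
n`. -/
theorem positiveRootsB_eq_image (n : ℕ) : positiveRootsB n = rootB n '' boxesB n := by
  ext v
  constructor
  · rintro (⟨i, rfl⟩ | ⟨i, j, hij, rfl⟩ | ⟨i, j, hij, rfl⟩)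
    · refine ⟨(i, n), mem_boxesB.2 ⟨i.2, by dsimp only; omega⟩, ?_⟩
      rw [rootB, signedBasis_self, signedBasis_of_lt i.2, sub_zero]
    · have : (i : ℕ) < j := hij
      refine ⟨(i, j), mem_boxesB.2 ⟨hij, by dsimp only; omega⟩, ?_⟩
      rw [rootB, signedBasis_of_lt i.2, signedBasis_of_lt j.2]
    · have : (i : ℕ) < j := hij
      refine ⟨(i, 2 * n - j), mem_boxesB.2 ⟨by dsimp only; omega, by dsimp only; omega⟩, ?_⟩
      rw [rootB, signedBasis_of_lt i.2, signedBasis_two_mul_sub (by omega),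
        signedBasis_of_lt j.2, sub_neg_eq_add]
  · rintro ⟨⟨a, b⟩, hab, rfl⟩
    obtain ⟨hab, hab'⟩ := mem_boxesB.1 (Finset.mem_coe.1 hab)
    dsimp only at hab hab'
    have ha : a < n := by omega
    rcases lt_trichotomy b n with hb | rfl | hb
    · exact Or.inr (Or.inl ⟨⟨a, ha⟩, ⟨b, hb⟩, hab, by
        rw [rootB, signedBasis_of_lt ha, signedBasis_of_lt hb]⟩)
    · exact Or.inl ⟨⟨a, ha⟩, by rw [rootB, signedBasis_of_lt ha, signedBasis_self, sub_zero]⟩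
    · refine Or.inr (Or.inr ⟨⟨a, ha⟩, ⟨2 * n - b, by omega⟩, by
        rw [Fin.mk_lt_mk]; omega, ?_⟩)
      have h : signedBasis n b = -signedBasis n (2 * n - b) := by
        rw [← signedBasis_two_mul_sub (Nat.sub_le _ _), Nat.sub_sub_self (by omega)]
      rw [rootB, h, signedBasis_of_lt ha, signedBasis_of_lt, sub_neg_eq_add]

theorem injOn_rootB (n : ℕ) : Set.InjOn (rootB n) (boxesB n) := by
  have key : ∀ {a b a' b' : ℕ}, (a, b) ∈ boxesB n → (a', b') ∈ boxesB n →
      rootB n (a, b) = rootB n (a', b') → (a = a' ∨ a + b' = 2 * n) ∧ (b ≠ n → a = a' → b = b') := by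
    intro a b a' b' h1 h2 h
    have hcoord : ∀ i (hi : i < n), rootB n (a, b) ⟨i, hi⟩ = rootB n (a', b') ⟨i, hi⟩ :=
      fun i hi => by rw [h]
    simp only [rootB_apply h1, rootB_apply h2] at hcoord
    rw [mem_boxesB] at h1 h2
    dsimp only at h1 h2
    refine ⟨?_, fun hbn haa => ?_⟩
    · have := hcoord a (by omega)
      split_ifs at this <;> first | omega | (norm_num at this)
    · rcases lt_or_gt_of_ne hbn with hb | hb
      · have := hcoord b hb
        split_ifs at this <;> first | omega | (norm_num at this)
      · have := hcoord (2 * n - b) (by omega)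
        split_ifs at this <;> first | omega | (norm_num at this)
  rintro ⟨a, b⟩ h1 ⟨a', b'⟩ h2 h
  rw [Finset.mem_coe] at h1 h2
  have k1 := key h1 h2 h
  have k2 := key h2 h1 h.symm
  rw [mem_boxesB] at h1 h2
  dsimp only at h1 h2
  -- Otherwise `a + b' = 2 n = a' + b`, and the two anti-diagonal inequalities give `a' < a` and `a
  -- < a'`.
  obtain rfl : a = a' := by omega
  rw [Prod.mk.injEq]
  refine ⟨rfl, ?_⟩
  by_cases hb : b = n
  · by_cases hb' : b' = n
    · omega
    · exact (k2.2 hb' rfl).symm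
  · exact k1.2 hb rfl

theorem inner_signedBasis_toLp {n : ℕ} {x : ℕ → ℝ} (hx : x n = 0) {a : ℕ} (ha : a ≤ 2 * n) :
    inner ℝ (signedBasis n a) (WithLp.toLp 2 fun i : Fin n => x i) = antisymmExtend n x a := by
  unfold antisymmExtend
  rcases lt_trichotomy a n with h | rfl | h
  · rw [signedBasis_of_lt h, if_pos h.le]
    simp [EuclideanSpace.inner_single_left]
  · rw [signedBasis_self, if_pos le_rfl, inner_zero_left, hx]
  · rw [← Nat.sub_sub_self ha, signedBasis_two_mul_sub (Nat.sub_le _ _),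
      signedBasis_of_lt (by omega), Nat.sub_sub_self ha, if_neg (by omega)]
    simp [EuclideanSpace.inner_single_left]

/-- Boxes compare only indices with `a + b < 2 n`. The reflection `a ↦ 2 n - a`, which changes the
sign, covers `a + b > 2 n`; for `a + b = 2 n` both are compared with the middle vector `0`. -/
theorem inner_signedBasis_anti {n : ℕ} {v : EuclideanSpace ℝ (Fin n)}
    (hv : ∀ p ∈ boxesB n, (0 : ℝ) < inner ℝ (rootB n p) v) {a b : ℕ} (hab : a < b)
    (hb : b ≤ 2 * n) : (inner ℝ (signedBasis n b) v : ℝ) < inner ℝ (signedBasis n a) v := by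
  have key : ∀ a b, a < b → a + b < 2 * n →
      (inner ℝ (signedBasis n b) v : ℝ) < inner ℝ (signedBasis n a) v := by
    intro a b h1 h2
    have := hv (a, b) (mem_boxesB.2 ⟨h1, h2⟩)
    rw [rootB, inner_sub_left] at this
    exact sub_pos.1 this
  rcases lt_trichotomy (a + b) (2 * n) with h | h | h
  · exact key a b hab h
  · have h1 := key a n (by omega) (by omega)
    rw [signedBasis_self, inner_zero_left] at h1
    obtain rfl : b = 2 * n - a := by omega
    rw [signedBasis_two_mul_sub (by omega), inner_neg_left]
    linarith
  · have h1 := key (2 * n - b) (2 * n - a) (by omega) (by omega)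
    rw [signedBasis_two_mul_sub hb, signedBasis_two_mul_sub (by omega), inner_neg_left,
      inner_neg_left] at h1
    linarith

theorem exists_inner_rootB {n : ℕ} {I : Finset (ℕ × ℕ)} (hI : I ∈ idealsB n) :
    ∃ v : EuclideanSpace ℝ (Fin n), ∀ p ∈ boxesB n, 0 < inner ℝ (rootB n p) v ∧
      inner ℝ (rootB n p) v ≠ (1 : ℝ) ∧ (inner ℝ (rootB n p) v < (1 : ℝ) ↔ p ∈ I) := by
  obtain ⟨x, hxn, hx⟩ := exists_antisymmExtend_sub_lt_one_iff hI 0 n.zero_le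
  refine ⟨WithLp.toLp 2 fun i : Fin n => x i, ?_⟩
  rintro ⟨a, b⟩ hp
  obtain ⟨h1, h2⟩ := mem_boxesB.1 hp
  dsimp only at h1 h2
  rw [rootB, inner_sub_left, inner_signedBasis_toLp hxn (by dsimp only; omega),
    inner_signedBasis_toLp hxn (by dsimp only; omega)]
  exact ⟨sub_pos.2 (antisymmExtend_lt hxn (fun a ha han => (hx a ha han).1) a.zero_le h1
    (by omega)), (hx a a.zero_le (by omega)).2.1 b h1 h2⟩

theorem qFussCatalan_positiveRootsB (n : ℕ) :
    qFussCatalan (positiveRootsB n) 1 = ∑ I ∈ idealsB n, X ^ I.card := by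
  have h0 : ∃ v : EuclideanSpace ℝ (Fin n), ∀ p ∈ boxesB n,
      0 < inner ℝ (rootB n p) v ∧ inner ℝ (rootB n p) v < (1 : ℝ) := by
    -- The ideal of all boxes belongs to the fundamental region.
    obtain ⟨v, hv⟩ := exists_inner_rootB (n := n) (I := boxesB n)
      (mem_idealsB.2 ⟨subset_rfl, fun _ _ q hq _ _ => hq⟩)
    exact ⟨v, fun p hp => ⟨(hv p hp).1, (hv p hp).2.2.2 hp⟩⟩
  rw [positiveRootsB_eq_image]
  refine qFussCatalan_eq_sum (injOn_rootB n) le_rfl h0 ?_ (idealsB n)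
    (fun v => (boxesB n).filter fun p => ¬ (1 : ℝ) < inner ℝ (rootB n p) v) Finset.card ?_ ?_ ?_ ?_
  · obtain ⟨v, hv⟩ := h0
    refine eq_of_eq_smul_of_coord (v := v) ?_ ?_
    · rintro _ ⟨p, hp, rfl⟩ i
      rw [rootB_apply hp]
      rw [Finset.mem_coe, mem_boxesB] at hp
      split_ifs <;> first | omega | norm_num
    · rintro _ ⟨p, hp, rfl⟩
      exact (hv p hp).1
  · intro v hv
    have hanti : ∀ {a b : ℕ}, a ≤ b → b ≤ 2 * n →
        (inner ℝ (signedBasis n b) v : ℝ) ≤ inner ℝ (signedBasis n a) v := by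
      intro a b hab hb
      rcases eq_or_lt_of_le hab with rfl | hab
      · exact le_rfl
      · exact (inner_signedBasis_anti (fun p hp => (hv _ ⟨p, hp, rfl⟩).1) hab hb).le
    refine mem_idealsB.2 ⟨Finset.filter_subset _ _, ?_⟩
    rintro ⟨a, b⟩ hp ⟨c, d⟩ hq hac hdb
    rw [Finset.mem_filter] at hp ⊢
    refine ⟨hq, ?_⟩
    have hp' := mem_boxesB.1 hp.1
    have hq' := mem_boxesB.1 hq
    dsimp only at hp' hq' hac hdb
    have h1 := hanti hac (by omega)
    have h2 := hanti hdb (by omega)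
    have h3 := hp.2
    simp only [rootB, inner_sub_left, not_lt] at h3 ⊢
    linarith
  · intro I hI
    obtain ⟨v, hv⟩ := exists_inner_rootB hI
    refine ⟨v, ?_, ?_⟩
    · rintro _ ⟨p, hp, rfl⟩
      exact ⟨(hv p hp).1, by simpa using (hv p hp).2.1⟩
    · ext p
      rw [Finset.mem_filter]
      constructor
      · rintro ⟨hp, h⟩
        exact (hv p hp).2.2.1 (lt_of_le_of_ne (not_lt.1 h) (hv p hp).2.1)
      · intro hp
        have hpB := (mem_idealsB.1 hI).1 hp
        exact ⟨hpB, ((hv p hpB).2.2.2 hp).not_gt⟩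
  · intro u _ v _
    simp only [Finset.Icc_self, Finset.mem_singleton, forall_eq, Nat.cast_one,
      Finset.filter_inj', not_iff_not]
  · intro v _
    rw [Finset.Icc_self, Finset.product_singleton, Finset.filter_map, Finset.card_map]
    simp

end TypeB


/-! ### Type B: ideals of boxes and lattice paths -/

section PathsB

theorem north_zero {N : ℕ} (w : Fin N → Bool) : north w 0 = 0 := by simp [north]

theorem east_zero {N : ℕ} (w : Fin N → Bool) : east w 0 = 0 := by simp [east]

theorem card_filter_lt_succ {N : ℕ} (w : Fin N → Bool) (c : Bool) {t : ℕ} (ht : t < N) :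
    (Finset.univ.filter fun s : Fin N => (s : ℕ) < t + 1 ∧ w s = c).card =
      (Finset.univ.filter fun s : Fin N => (s : ℕ) < t ∧ w s = c).card +
        if w ⟨t, ht⟩ = c then 1 else 0 := by
  split_ifs with h
  · have : (Finset.univ.filter fun s : Fin N => (s : ℕ) < t + 1 ∧ w s = c) =
        insert ⟨t, ht⟩ (Finset.univ.filter fun s : Fin N => (s : ℕ) < t ∧ w s = c) := by
      ext s
      simp only [Finset.mem_filter, Finset.mem_univ, true_and, Finset.mem_insert, Nat.lt_succ_iff,
        le_iff_eq_or_lt, Fin.ext_iff, or_and_right]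
      refine or_congr_left (and_iff_left_of_imp fun hs => ?_)
      rw [← h]
      exact congrArg w (Fin.ext hs)
    rw [this, Finset.card_insert_of_notMem (by simp)]
  · rw [add_zero]
    refine congrArg _ (Finset.filter_congr fun s _ => and_congr_left fun hs => ?_)
    have : (s : ℕ) ≠ t := fun hst => h (by rw [← hs]; exact congrArg w (Fin.ext hst.symm))
    omega

theorem north_succ {N : ℕ} (w : Fin N → Bool) {t : ℕ} (ht : t < N) :
    north w (t + 1) = north w t + if w ⟨t, ht⟩ = true then 1 else 0 :=
  card_filter_lt_succ w true ht

theorem east_succ {N : ℕ} (w : Fin N → Bool) {t : ℕ} (ht : t < N) :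
    east w (t + 1) = east w t + if w ⟨t, ht⟩ = false then 1 else 0 :=
  card_filter_lt_succ w false ht

theorem north_mono {N : ℕ} (w : Fin N → Bool) : Monotone (north w) := fun _ _ h =>
  Finset.card_le_card fun s hs => by
    rw [Finset.mem_filter] at hs ⊢
    exact ⟨hs.1, hs.2.1.trans_le h, hs.2.2⟩

theorem east_mono {N : ℕ} (w : Fin N → Bool) : Monotone (east w) := fun _ _ h =>
  Finset.card_le_card fun s hs => by
    rw [Finset.mem_filter] at hs ⊢
    exact ⟨hs.1, hs.2.1.trans_le h, hs.2.2⟩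

theorem east_add_north {N : ℕ} (w : Fin N → Bool) {t : ℕ} (ht : t ≤ N) :
    east w t + north w t = t := by
  induction t with
  | zero => rw [east_zero, north_zero]
  | succ t ih =>
    have := ih (by omega)
    rw [east_succ w ht, north_succ w ht]
    cases w ⟨t, ht⟩ <;> simp <;> omega

theorem mem_catalanPathsB {n : ℕ} {w : Fin (2 * n) → Bool} :
    w ∈ catalanPathsB n ↔ ∀ t ≤ 2 * n, east w t ≤ north w t := by
  simp only [catalanPathsB, Finset.mem_filter, Finset.mem_univ, true_and]
  exact ⟨fun h t ht => h ⟨t, by omega⟩, fun h t => h t (by omega)⟩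

/-- The boxes confined by the path, the diagonal and the anti-diagonal. -/
def confinedBoxes {n : ℕ} (w : Fin (2 * n) → Bool) : Finset (ℕ × ℕ) :=
  (boxesB n).filter fun p => ∃ s : Fin (2 * n), w s = true ∧ north w s = p.2 ∧ east w s ≤ p.1

theorem areaB_eq_card_confinedBoxes {n : ℕ} (w : Fin (2 * n) → Bool) :
    areaB w = (confinedBoxes w).card := by
  rw [areaB, confinedBoxes, boxesB, Finset.filter_filter]
  simp only [and_assoc]

/-- A path that goes north from height `b` went north from each height `d ≤ b` no later, hence no
further east. -/
theorem confinedBoxes_mem_idealsB {n : ℕ} (w : Fin (2 * n) → Bool) :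
    confinedBoxes w ∈ idealsB n := by
  refine mem_idealsB.2 ⟨Finset.filter_subset _ _, ?_⟩
  rintro ⟨a, b⟩ hp ⟨c, d⟩ hq hac hdb
  rw [confinedBoxes, Finset.mem_filter] at hp ⊢
  obtain ⟨-, s, hs, hsn, hse⟩ := hp
  refine ⟨hq, ?_⟩
  dsimp only at *
  have hex : ∃ t, d < north w t := ⟨s + 1, by rw [north_succ w s.2, if_pos hs, hsn]; omega⟩
  have hle : Nat.find hex ≤ s + 1 :=
    Nat.find_min' hex (by rw [north_succ w s.2, if_pos hs, hsn]; omega)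
  have hspec := Nat.find_spec hex
  obtain ⟨t, ht⟩ : ∃ t, Nat.find hex = t + 1 := by
    refine Nat.exists_eq_succ_of_ne_zero fun h => ?_
    rw [h, north_zero] at hspec
    omega
  have hmin := Nat.find_min hex (m := t) (by omega)
  rw [ht] at hspec hle
  have htN : t < 2 * n := by omega
  rw [north_succ w htN] at hspec
  have hw : w ⟨t, htN⟩ = true := by
    by_contra h
    rw [if_neg h] at hspec
    omega
  rw [if_pos hw] at hspec
  exact ⟨⟨t, htN⟩, hw, by dsimp only; omega,
    (east_mono w (show t ≤ s by omega)).trans (hse.trans hac)⟩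

/-- An east step from the diagonal would leave the allowed region, and an east step along the bottom
of a confined box would put that box above the path. This recovers each step from the position and
the confined boxes, which gives injectivity. -/
theorem north_step_iff {n : ℕ} {w : Fin (2 * n) → Bool} (hw : w ∈ catalanPathsB n)
    (t : Fin (2 * n)) :
    w t = true ↔ east w t = north w t ∨ (east w t, north w t) ∈ confinedBoxes w := by
  have hle := mem_catalanPathsB.1 hw t t.2.le
  have hsum := east_add_north w t.2.le
  constructor
  · intro h
    rcases eq_or_lt_of_le hle with h' | h'
    · exact Or.inl h'
    · exact Or.inr (Finset.mem_filter.2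
        ⟨mem_boxesB.2 ⟨h', by dsimp only; omega⟩, t, h, rfl, le_rfl⟩)
  · intro h
    by_contra hwt
    have h1 := mem_catalanPathsB.1 hw (t + 1) t.2
    have h2 := east_succ w t.2
    rw [if_pos (by simpa using hwt)] at h2
    rw [north_succ w t.2, if_neg hwt, h2] at h1
    rcases h with h | h
    · omega
    · obtain ⟨-, s, hs, hsn, hse⟩ := Finset.mem_filter.1 h
      dsimp only at hsn hse
      rcases lt_trichotomy s t with hst | rfl | hst
      · have h3 := north_mono w (show (s : ℕ) + 1 ≤ t from hst)
        rw [north_succ w s.2, if_pos hs] at h3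
        omega
      · exact hwt hs
      · have h3 := east_mono w (show (t : ℕ) + 1 ≤ s from hst)
        omega

theorem injOn_confinedBoxes (n : ℕ) :
    Set.InjOn (confinedBoxes (n := n)) (catalanPathsB n) := by
  intro w hw u hu h
  funext t
  induction t using WellFoundedLT.induction with
  | ind t ih =>
    have hc : ∀ c, (Finset.univ.filter fun s : Fin (2 * n) => (s : ℕ) < t ∧ w s = c) =
        Finset.univ.filter fun s : Fin (2 * n) => (s : ℕ) < t ∧ u s = c := fun c =>
      Finset.filter_congr fun s _ => and_congr_right fun hs => by rw [ih s hs]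
    have hn : north w t = north u t := congrArg Finset.card (hc true)
    have he : east w t = east u t := congrArg Finset.card (hc false)
    rw [Bool.eq_iff_iff, north_step_iff hw, north_step_iff hu, hn, he, h]

/-- The positions of the lattice path that goes north on the diagonal and on the boxes of `I`. -/
def greedyPath (I : Finset (ℕ × ℕ)) : ℕ → ℕ × ℕ
  | 0 => (0, 0)
  | t + 1 =>
    if (greedyPath I t).1 = (greedyPath I t).2 ∨ greedyPath I t ∈ I then
      ((greedyPath I t).1, (greedyPath I t).2 + 1)
    else ((greedyPath I t).1 + 1, (greedyPath I t).2)

theorem exists_confinedBoxes_eq {n : ℕ} {I : Finset (ℕ × ℕ)} (hI : I ∈ idealsB n) :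
    ∃ w ∈ catalanPathsB n, confinedBoxes w = I := by
  obtain ⟨hIB, hI⟩ := mem_idealsB.1 hI
  set w : Fin (2 * n) → Bool := fun s =>
    decide ((greedyPath I s).1 = (greedyPath I s).2 ∨ greedyPath I s ∈ I) with hwdef
  have hpos : ∀ t ≤ 2 * n, (east w t, north w t) = greedyPath I t := by
    intro t ht
    induction t with
    | zero => rw [east_zero, north_zero, greedyPath]
    | succ t ih =>
      have ih := ih (by omega)
      rw [greedyPath, ← ih, east_succ w ht, north_succ w ht]
      by_cases h : east w t = north w t ∨ (east w t, north w t) ∈ I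
      · have : w ⟨t, ht⟩ = true := by simpa [hwdef, ← ih] using h
        rw [this, if_pos h]
        simp
      · have : w ⟨t, ht⟩ = false := by simpa [hwdef, ← ih] using h
        rw [this, if_neg h]
        simp
  have hstep : ∀ t : Fin (2 * n),
      w t = true ↔ east w t = north w t ∨ (east w t, north w t) ∈ I := by
    intro t
    simp [hwdef, ← hpos t t.2.le]
  have hw : ∀ t ≤ 2 * n, east w t ≤ north w t := by
    intro t ht
    induction t with
    | zero => rw [east_zero, north_zero]
    | succ t ih =>
      have ih := ih (by omega)
      rw [east_succ w ht, north_succ w ht]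
      by_cases h : east w t = north w t
      · rw [(hstep ⟨t, ht⟩).2 (Or.inl h)]
        simp [h]
      · split_ifs <;> omega
  refine ⟨w, mem_catalanPathsB.2 hw, ?_⟩
  ext ⟨a, b⟩
  rw [confinedBoxes, Finset.mem_filter]
  constructor
  · rintro ⟨hab, s, hs, hsn, hse⟩
    have hab' := mem_boxesB.1 hab
    dsimp only at hsn hse hab'
    rcases (hstep s).1 hs with h | h
    · omega
    · exact hI _ h _ hab hse hsn.ge
  · intro hab
    have hab' := mem_boxesB.1 (hIB hab)
    dsimp only at hab'
    refine ⟨hIB hab, ?_⟩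
    -- The path has to leave the rectangle `x ≤ a`, `y ≤ b`, and the first exit is the north step
    -- sought.
    have hexit : a < east w (a + b + 1) ∨ b < north w (a + b + 1) := by
      have := east_add_north w (t := a + b + 1) (by omega)
      omega
    have hex : ∃ t, a < east w t ∨ b < north w t := ⟨_, hexit⟩
    have hle : Nat.find hex ≤ a + b + 1 := Nat.find_min' hex hexit
    have hspec := Nat.find_spec hex
    obtain ⟨t, ht⟩ : ∃ t, Nat.find hex = t + 1 := by
      refine Nat.exists_eq_succ_of_ne_zero fun h => ?_
      rw [h, north_zero, east_zero] at hspec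
      omega
    have hmin := Nat.find_min hex (m := t) (by omega)
    rw [ht] at hspec hle
    have htN : t < 2 * n := by omega
    rw [north_succ w htN, east_succ w htN] at hspec
    have hwt : w ⟨t, htN⟩ = true := by
      by_contra h
      -- An exit to the east would start at `x = a` and height at most `b`: on the diagonal or, by
      -- the ideal property, at a box of `I`, where the greedy path goes north.
      rw [if_neg h, if_pos (by simpa using h)] at hspec
      have h1 := hw t htN.le
      rw [hstep] at h
      dsimp only at h
      obtain rfl : a = east w t := by omega
      exact h (Or.inr (hI _ hab _ (mem_boxesB.2 ⟨by dsimp only; omega, by dsimp only; omega⟩)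
        le_rfl (by dsimp only; omega)))
    rw [hwt] at hspec
    simp only [if_true, reduceCtorEq, if_false, add_zero] at hspec
    exact ⟨⟨t, htN⟩, hwt, by dsimp only; omega, by dsimp only; omega⟩

theorem catalanB_eq_sum (n : ℕ) : catalanB n = ∑ I ∈ idealsB n, X ^ I.card := by
  rw [catalanB]
  refine Finset.sum_nbij confinedBoxes (fun w _ => confinedBoxes_mem_idealsB w)
    (injOn_confinedBoxes n) (fun I hI => ?_) fun w _ => by rw [areaB_eq_card_confinedBoxes]
  obtain ⟨w, hw, rfl⟩ := exists_confinedBoxes_eq hI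
  exact ⟨w, hw, rfl⟩

end PathsB

end Shi

theorem mainTheorem1 :
    (∀ m n : ℕ, 1 ≤ m →
      Shi.qFussCatalan (Shi.positiveRootsA n) m = Shi.carlitzFussCatalan n m) ∧
    (∀ n : ℕ, Shi.qFussCatalan (Shi.positiveRootsB n) 1 = Shi.catalanB n) :=
  ⟨fun _ n hm => Shi.qFussCatalan_positiveRootsA hm n,
    fun n => (Shi.qFussCatalan_positiveRootsB n).trans (Shi.catalanB_eq_sum n).symm⟩
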